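/- Let $(K,v)$ be a valued field of characteristic $p>0$ (with $v$ of arbitrary rank), with $v$ extended to an algebraic closure $\tilde K$ of $K$. For a subextension $E|K$ of $\tilde K|K$, write $vE$ and $Ev$ for its value group and residue field; $(E|K,v)$ is immediate if $vE=vK$ and $Ev=Kv$. Let $\widetilde{vK}$ be the divisible hull of $vK$. For $a\in\tilde K$ put $v(a-K)=\{v(a-c)\mid c\in K\}$; $a$ is called weakly immediate over $K$ if this set has no maximal element, and $\operatorname{dist}(a,K)$ is the cut in $\widetilde{vK}$ whose lower cut set is the smallest initial segment of $\widetilde{vK}$ containing $v(a-K)\cap\widetilde{vK}$. For $\alpha\in vK$, $\alpha+\operatorname{dist}(a,K)$ is the cut whose lower cut set is shifted by $\alpha$. For a subextension $L|K$ of $\tilde K|K$ to which $v$ extends uniquely from $K$, let $\operatorname{ndd}(L|K,v)$, the number of distances in $(L|K,v)$ that are distinct modulo $vK$, be the minimal $n\geq 0$ for which there are elements $a_1,\dots,a_n\in L\setminus K$, weakly immediate over $K$, such that for every $b\in L\setminus K$ that is weakly immediate over $K$ there are $i\in\{1,\dots,n\}$ and $\alpha\in vK$ with $\operatorname{dist}(b,K)=\alpha+\operatorname{dist}(a_i,K)$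 (and $\infty$ if there is no such $n$). If moreover $L|K$ is finite, its defect is $d(L|K,v)=[L:K]/\big((vL:vK)\,[Lv:Kv]\big)$. Let $K^{1/p}=\{c^{1/p}\mid c\in K\}\subseteq\tilde K$, and let $K'|K$ be a maximal immediate subextension of $(K^{1/p}|K,v)$. Assume that $K'|K$ is finite, of degree $p^m$. Then $$\operatorname{ndd}(K^{1/p}|K,v)=\operatorname{ndd}(K'|K,v)\leq m .$$ Moreover, if $K$ has finite $p$-degree, that is, if $[K^{1/p}:K]<\infty$, and if $d(K^{1/p}|K,v)=p^s$, then $\operatorname{ndd}(K^{1/p}|K,v)\leq s$. -/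

import Mathlib

namespace DistanceCount

open scoped Pointwise

variable {K Ω Γ : Type*} [Field K] [Field Ω] [Algebra K Ω]
  [AddCommGroup Γ] [LinearOrder Γ] [IsOrderedAddMonoid Γ]

/-- The field `K^{1/p}` of all `p`-th roots, inside `Ω`, of elements of a field `K` of
characteristic `p`. -/
def pthRoots (K Ω : Type*) [Field K] [Field Ω] [Algebra K Ω] (p : ℕ) [Fact p.Prime]
    [CharP K p] : IntermediateField K Ω where
  carrier := {x | ∃ c : K, x ^ p = algebraMap K Ω c}
  mul_mem' := by
    rintro x y ⟨c, hc⟩ ⟨d, hd⟩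
    exact ⟨c * d, by rw [mul_pow, hc, hd, map_mul]⟩
  add_mem' := by
    rintro x y ⟨c, hc⟩ ⟨d, hd⟩
    have : CharP Ω p := charP_of_injective_algebraMap (algebraMap K Ω).injective p
    exact ⟨c + d, by rw [add_pow_char, hc, hd, map_add]⟩
  algebraMap_mem' := fun c => ⟨c ^ p, by rw [map_pow]⟩
  inv_mem' := by
    rintro x ⟨c, hc⟩
    exact ⟨c⁻¹, by rw [inv_pow, hc, map_inv₀]⟩

/-- The value group `vE = {v x | 0 ≠ x ∈ E}` of an intermediate field `E`. (For a valuation of a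
field, `v x` is finite if and only if `x ≠ 0`.) -/
def valueGroup (v : AddValuation Ω (WithTop Γ)) (E : IntermediateField K Ω) : AddSubgroup Γ where
  carrier := {γ | ∃ x ∈ E, v x = (γ : WithTop Γ)}
  zero_mem' := ⟨1, E.one_mem, by simp⟩
  add_mem' := by
    rintro a b ⟨x, hx, hxa⟩ ⟨y, hy, hyb⟩
    exact ⟨x * y, E.mul_mem hx hy, by rw [AddValuation.map_mul, hxa, hyb, WithTop.coe_add]⟩
  neg_mem' := by
    rintro a ⟨x, hx, hxa⟩
    refine ⟨x⁻¹, E.inv_mem hx, ?_⟩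
    have hx0 : x ≠ 0 := by
      rintro rfl
      simp at hxa
    have h : v x + v x⁻¹ = 0 := by rw [← AddValuation.map_mul, mul_inv_cancel₀ hx0]; simp
    rw [hxa] at h
    cases hy : v x⁻¹ with
    | top => rw [hy] at h; simp at h
    | coe b =>
      rw [hy] at h
      have h' : a + b = 0 := by exact_mod_cast h
      rw [eq_neg_of_add_eq_zero_right h']

/-- The residue field `Ωv` of `(Ω, v)`. -/
abbrev residueField (v : AddValuation Ω (WithTop Γ)) : Type _ :=
  IsLocalRing.ResidueField (AddValuation.toValuation v).valuationSubring

/-- The residue field `Ev` of an intermediate field `E`, as a subfield of `Ωv`: the set of residues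
of the elements of `E` of value `≥ 0`. -/
def residueSubfield (v : AddValuation Ω (WithTop Γ)) (E : IntermediateField K Ω) :
    Subfield (residueField v) where
  carrier := {r | ∃ x : (AddValuation.toValuation v).valuationSubring, (x : Ω) ∈ E ∧ IsLocalRing.residue _ x = r}
  zero_mem' := ⟨0, E.zero_mem, map_zero _⟩
  one_mem' := ⟨1, E.one_mem, map_one _⟩
  add_mem' := by
    rintro _ _ ⟨x, hx, rfl⟩ ⟨y, hy, rfl⟩
    exact ⟨x + y, E.add_mem hx hy, map_add _ _ _⟩
  mul_mem' := by
    rintro _ _ ⟨x, hx, rfl⟩ ⟨y, hy, rfl⟩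
    exact ⟨x * y, E.mul_mem hx hy, map_mul _ _ _⟩
  neg_mem' := by
    rintro _ ⟨x, hx, rfl⟩
    exact ⟨-x, E.neg_mem hx, map_neg _ _⟩
  inv_mem' := by
    rintro _ ⟨x, hx, rfl⟩
    by_cases h : IsLocalRing.residue _ x = 0
    · exact ⟨0, E.zero_mem, by rw [h, inv_zero, map_zero]⟩
    · obtain ⟨u, rfl⟩ := (IsLocalRing.residue_ne_zero_iff_isUnit x).1 h
      refine ⟨(u⁻¹ : ((AddValuation.toValuation v).valuationSubring)ˣ), ?_, ?_⟩
      · have h1 : ((u : (AddValuation.toValuation v).valuationSubring) : Ω) *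
            (((u⁻¹ : ((AddValuation.toValuation v).valuationSubring)ˣ) : (AddValuation.toValuation v).valuationSubring) : Ω) = 1 := by
          rw [← MulMemClass.coe_mul, Units.mul_inv]; rfl
        rw [eq_inv_of_mul_eq_one_right h1]
        exact E.inv_mem hx
      · refine eq_inv_of_mul_eq_one_right ?_
        rw [← map_mul, Units.mul_inv, map_one]

/-- `(E|K, v)` is immediate: `vE = vK` and `Ev = Kv`. -/
def IsImmediate (v : AddValuation Ω (WithTop Γ)) (E : IntermediateField K Ω) : Prop :=
  valueGroup v E = valueGroup v (⊥ : IntermediateField K Ω) ∧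
    residueSubfield v E = residueSubfield v (⊥ : IntermediateField K Ω)

/-- The defect `d(E|K, v) = [E:K] / ((vE:vK) [Ev:Kv])` (for finite `E|K` to which `v` extends
uniquely from `K`). -/
noncomputable def defect (v : AddValuation Ω (WithTop Γ)) (E : IntermediateField K Ω) : ℚ :=
  (Module.finrank K E : ℚ) /
    ((valueGroup v (⊥ : IntermediateField K Ω)).relIndex (valueGroup v E) *
      Subfield.relfinrank (residueSubfield v (⊥ : IntermediateField K Ω)) (residueSubfield v E))

/-- The divisible hull of `vK`: all `γ` having a positive multiple in `vK`. When `Ω` is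
algebraically closed, `vΩ` is divisible, so this group (which is contained in `vΩ`) is divisible. -/
def divHull (K : Type*) [Field K] [Algebra K Ω] (v : AddValuation Ω (WithTop Γ)) :
    AddSubgroup Γ where
  carrier := {γ | ∃ n : ℕ, 0 < n ∧ n • γ ∈ valueGroup v (⊥ : IntermediateField K Ω)}
  zero_mem' := ⟨1, one_pos, by simp⟩
  add_mem' := by
    rintro a b ⟨n, hn, hna⟩ ⟨k, hk, hkb⟩
    refine ⟨n * k, Nat.mul_pos hn hk, ?_⟩
    rw [smul_add, mul_comm n k, mul_smul, mul_comm k n, mul_smul]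
    exact AddSubgroup.add_mem _ (AddSubgroup.nsmul_mem _ hna k) (AddSubgroup.nsmul_mem _ hkb n)
  neg_mem' := by
    rintro a ⟨n, hn, hna⟩
    exact ⟨n, hn, by rw [smul_neg]; exact AddSubgroup.neg_mem _ hna⟩

/-- The set `v(a - K) = {v(a - c) | c ∈ K}`. -/
def valueSet (K : Type*) [Field K] [Algebra K Ω] (v : AddValuation Ω (WithTop Γ)) (a : Ω) :
    Set (WithTop Γ) :=
  {γ | ∃ c : K, v (a - algebraMap K Ω c) = γ}

/-- `a` is weakly immediate over `K`: the set `v(a - K)` has no maximal element. -/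
def IsWeaklyImmediate (K : Type*) [Field K] [Algebra K Ω] (v : AddValuation Ω (WithTop Γ))
    (a : Ω) : Prop :=
  ¬ ∃ γ, IsGreatest (valueSet K v a) γ

/-- The distance `dist(a, K)`: the cut in the divisible hull of `vK`, given by its lower cut set,
the smallest initial segment containing the elements of `v(a - K)` that lie in the hull. -/
def dist (K : Type*) [Field K] [Algebra K Ω] (v : AddValuation Ω (WithTop Γ)) (a : Ω) :
    LowerSet (divHull K v) :=
  lowerClosure {γ : divHull K v | ((γ : Γ) : WithTop Γ) ∈ valueSet K v a}

/-- `dist(a, K)` and `dist(b, K)` are equal modulo `vK`: one has `dist(a, K) = α + dist(b, K)` for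
some `α ∈ vK`, where `α + D` is the cut whose lower cut set is that of `D` shifted by `α`. -/
def DistEqMod (K : Type*) [Field K] [Algebra K Ω] (v : AddValuation Ω (WithTop Γ))
    (a b : Ω) : Prop :=
  ∃ α : divHull K v, (α : Γ) ∈ valueGroup v (⊥ : IntermediateField K Ω) ∧
    dist K v a = α +ᵥ dist K v b

/-- `ndd(L|K, v)`, the number of distances in `(L|K, v)` that are distinct modulo `vK`: the minimal
`n` such that there are `a₁, …, aₙ ∈ L \ K`, weakly immediate over `K`, such that the distance of
every `b ∈ L \ K` that is weakly immediate over `K` is equal modulo `vK` to the distance of one of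
them. Its value is `⊤` if there is no such `n`. -/
noncomputable def ndd (v : AddValuation Ω (WithTop Γ)) (L : IntermediateField K Ω) : ℕ∞ :=
  sInf {N : ℕ∞ | ∃ n : ℕ, N = n ∧ ∃ a : Fin n → Ω,
    (∀ i, a i ∈ L ∧ a i ∉ (⊥ : IntermediateField K Ω) ∧ IsWeaklyImmediate K v (a i)) ∧
    ∀ b ∈ L, b ∉ (⊥ : IntermediateField K Ω) → IsWeaklyImmediate K v b →
      ∃ i, DistEqMod K v b (a i)}

end DistanceCount

/-! Everything rests on a Kaplansky-type fact. Let `aᵖ ∈ F` and suppose that `v(a - F)` has no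
maximum. As `c ∈ F` approaches `a`, the value of a polynomial at `c` is eventually affine in `v(a -
c)`, with slope the number of its roots that are closer to `a` than all of `F`. Comparing slopes in
a division with remainder shows that polynomials of degree less than `p` have no such root
(`NoMax.not_isClose`). Hence `F(a)|F` is immediate of degree `p`. If `b = f(a)` is another such
generator and `a = g(b)`, a bound on logarithmic derivatives compares `v(b - F)` with `v(f'(a)) +
v(a - F)`, in both directions because `f'(a) g'(b) = 1`; so the two sets are mutually cofinal
(`NoMax.exists_shift`).

Now let `b ∈ K^{1/p}` be weakly immediate over `K` and let `F` contain `K`. Either some `e ∈ F` is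
closer to `b` than all of `K`, and then `b` and `e` have the same distance from `K`; or `v(b - K)`
is cofinal in `v(b - F)`. For `F = K'` the second case would make `K'(b)|K` immediate, against
maximality, so every distance already occurs in `K'` (`exists_distEqMod_of_maximal`). Climbing from
`K` to `K'` in `m` steps of degree `p`, all elements in the second case at a given step share one
distance modulo `vK`, so each step adds at most one (`Represents.exists_adjoinOver`).

For finite `p`-degree, the fundamental inequality for `K^{1/p}|K'` bounds `pᵐ` by the defect
(`le_of_defect_eq`). -/

namespace DistanceCount

open Polynomial Filter

/-! ### Values of polynomials near `a`, and the roots close to `a`. -/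

section CloseRoots

variable {F Ω Γ : Type*} [Field F] [Field Ω] [Algebra F Ω]
  [AddCommGroup Γ] [LinearOrder Γ] [IsOrderedAddMonoid Γ]
  {v : AddValuation Ω (WithTop Γ)} {a : Ω}

/-- The filter on `F` of approximation to `a`: it is generated by the sets of all `c` that are at
least as close to `a` as a given element of `F`. -/
def approx (F : Type*) [Field F] [Algebra F Ω] (v : AddValuation Ω (WithTop Γ)) (a : Ω) :
    Filter F :=
  ⨅ c₀ : F, 𝓟 {c | v (a - algebraMap F Ω c₀) ≤ v (a - algebraMap F Ω c)}

theorem eventually_approx {P : F → Prop} :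
    (∀ᶠ c in approx F v a, P c) ↔
      ∃ c₀, ∀ c, v (a - algebraMap F Ω c₀) ≤ v (a - algebraMap F Ω c) → P c := by
  unfold approx
  rw [Filter.Eventually, Filter.mem_iInf_of_directed]
  · simp [Set.subset_def]
  · intro x y
    rcases le_total (v (a - algebraMap F Ω x)) (v (a - algebraMap F Ω y)) with h | h
    · exact ⟨y, Filter.principal_mono.2 fun c hc => h.trans hc, le_rfl⟩
    · exact ⟨x, le_rfl, Filter.principal_mono.2 fun c hc => h.trans hc⟩

instance : (approx F v a).NeBot := by
  rw [← Filter.frequently_true_iff_neBot, Filter.Frequently, eventually_approx]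
  rintro ⟨c, hc⟩
  exact hc c le_rfl trivial

theorem eventually_approx_le (c₀ : F) :
    ∀ᶠ c in approx F v a, v (a - algebraMap F Ω c₀) ≤ v (a - algebraMap F Ω c) :=
  eventually_approx.2 ⟨c₀, fun _ h => h⟩

/-- The set `v(a - F)` has no maximal element. -/
def NoMax (F : Type*) [Field F] [Algebra F Ω] (v : AddValuation Ω (WithTop Γ)) (a : Ω) : Prop :=
  ∀ c : F, ∃ c' : F, v (a - algebraMap F Ω c) < v (a - algebraMap F Ω c')

theorem NoMax.eventually_lt (ha : NoMax F v a) (c₀ : F) :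
    ∀ᶠ c in approx F v a, v (a - algebraMap F Ω c₀) < v (a - algebraMap F Ω c) := by
  obtain ⟨c', hc'⟩ := ha c₀
  filter_upwards [eventually_approx_le c'] with c hc using hc'.trans_le hc

theorem NoMax.ne_top (ha : NoMax F v a) (c : F) : v (a - algebraMap F Ω c) ≠ ⊤ := by
  obtain ⟨c', hc'⟩ := ha c
  exact hc'.ne_top

theorem NoMax.exists_coe (ha : NoMax F v a) :
    ∃ γ : F → Γ, ∀ c, v (a - algebraMap F Ω c) = γ c :=
  ⟨fun c => (v (a - algebraMap F Ω c)).untop (ha.ne_top c), fun c => by simp⟩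

/-- `r` is closer to `a` than every element of `F`. -/
def IsClose (F : Type*) [Field F] [Algebra F Ω] (v : AddValuation Ω (WithTop Γ)) (a r : Ω) :
    Prop :=
  ∀ c : F, v (a - algebraMap F Ω c) < v (a - r)

theorem NoMax.isClose_self (ha : NoMax F v a) : IsClose F v a a := fun c => by
  simpa using (ha.ne_top c).lt_top

theorem IsClose.map_sub {r : Ω} (hr : IsClose F v a r) (c : F) :
    v (algebraMap F Ω c - r) = v (a - algebraMap F Ω c) := by
  have h : algebraMap F Ω c - r = (a - r) - (a - algebraMap F Ω c) := by ring
  rw [h, v.map_sub_eq_of_lt_right (hr c)]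

theorem NoMax.eventually_lt_of_not_isClose (ha : NoMax F v a) {r : Ω} (hr : ¬ IsClose F v a r) :
    ∀ᶠ c in approx F v a, v (a - r) < v (a - algebraMap F Ω c) := by
  simp only [IsClose, not_forall, not_lt] at hr
  obtain ⟨c₀, hc₀⟩ := hr
  filter_upwards [ha.eventually_lt c₀] with c hc using hc₀.trans_lt hc

theorem map_sub_eq_of_lt {r c : Ω} (h : v (a - r) < v (a - c)) : v (c - r) = v (a - r) := by
  have h' : c - r = (a - r) - (a - c) := by ring
  rw [h', v.map_sub_eq_of_lt_left h]

open Classical in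
/-- The number of close elements of a multiset. -/
noncomputable def closeCount (F : Type*) [Field F] [Algebra F Ω] (v : AddValuation Ω (WithTop Γ))
    (a : Ω) (s : Multiset Ω) : ℕ :=
  s.countP (IsClose F v a)

theorem closeCount_le_card (s : Multiset Ω) : closeCount F v a s ≤ Multiset.card s :=
  by classical exact Multiset.countP_le_card _ _

theorem closeCount_cons_of_isClose {r : Ω} (hr : IsClose F v a r) (s : Multiset Ω) :
    closeCount F v a (r ::ₘ s) = closeCount F v a s + 1 := by
  classical exact Multiset.countP_cons_of_pos _ hr

theorem closeCount_cons_of_not_isClose {r : Ω} (hr : ¬ IsClose F v a r) (s : Multiset Ω) :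
    closeCount F v a (r ::ₘ s) = closeCount F v a s := by
  classical exact Multiset.countP_cons_of_neg _ hr

theorem closeCount_pos {s : Multiset Ω} {r : Ω} (hr : r ∈ s) (h : IsClose F v a r) :
    0 < closeCount F v a s := by
  classical
  exact Multiset.countP_pos.2 ⟨r, hr, h⟩

/-- A close root `r` contributes `v(c - r) = v(a - c)`; any other root eventually contributes the
constant `v(a - r)`. -/
theorem NoMax.exists_eventually_prod (ha : NoMax F v a) {γ : F → Γ}
    (hγ : ∀ c, v (a - algebraMap F Ω c) = γ c) (s : Multiset Ω) :
    ∃ σ : Γ, ∀ᶠ c in approx F v a,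
      v (s.map (algebraMap F Ω c - ·)).prod = ((σ + closeCount F v a s • γ c : Γ) : WithTop Γ) := by
  classical
  induction s using Multiset.induction_on with
  | empty => exact ⟨0, by simp [closeCount]⟩
  | cons r s ih =>
    obtain ⟨σ, hσ⟩ := ih
    by_cases hr : IsClose F v a r
    · refine ⟨σ, ?_⟩
      filter_upwards [hσ] with c hc
      rw [Multiset.map_cons, Multiset.prod_cons, v.map_mul, hc, hr.map_sub, hγ,
        closeCount_cons_of_isClose hr, ← WithTop.coe_add, add_smul, one_smul]
      congr 1
      abel
    · obtain ⟨c₀, hc₀⟩ := (ha.eventually_lt_of_not_isClose hr).exists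
      obtain ⟨ρ, hρ⟩ := WithTop.ne_top_iff_exists.1 hc₀.ne_top
      refine ⟨ρ + σ, ?_⟩
      filter_upwards [hσ, ha.eventually_lt_of_not_isClose hr] with c hc hc'
      rw [Multiset.map_cons, Multiset.prod_cons, v.map_mul, hc, map_sub_eq_of_lt hc', ← hρ,
        closeCount_cons_of_not_isClose hr, ← WithTop.coe_add, add_assoc]

/-- The number of close roots of a polynomial. -/
noncomputable def closeRoots (v : AddValuation Ω (WithTop Γ)) (a : Ω) (q : F[X]) : ℕ :=
  closeCount F v a (q.aroots Ω)

theorem closeRoots_mul {q s : F[X]} (h : q * s ≠ 0) :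
    closeRoots v a (q * s) = closeRoots v a q + closeRoots v a s := by
  classical
  rw [closeRoots, aroots_mul h, closeCount, Multiset.countP_add]
  rfl

theorem aeval_eq_prod_aroots [IsAlgClosed Ω] (q : F[X]) (x : Ω) :
    aeval x q = algebraMap F Ω q.leadingCoeff * ((q.aroots Ω).map (x - ·)).prod := by
  have h := (IsAlgClosed.splits (q.map (algebraMap F Ω))).eval_eq_prod_roots x
  rw [eval_map_algebraMap, leadingCoeff_map] at h
  exact h

theorem ne_top_iff {x : Ω} : v x ≠ ⊤ ↔ x ≠ 0 := AddValuation.ne_top_iff v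

theorem algebraMap_leadingCoeff_ne_zero {q : F[X]} (hq : q ≠ 0) :
    algebraMap F Ω q.leadingCoeff ≠ 0 := by simpa using hq

theorem NoMax.exists_eventually_aeval [IsAlgClosed Ω] (ha : NoMax F v a) {γ : F → Γ}
    (hγ : ∀ c, v (a - algebraMap F Ω c) = γ c) {q : F[X]} (hq : q ≠ 0) :
    ∃ σ : Γ, ∀ᶠ c in approx F v a,
      v (aeval (algebraMap F Ω c) q) = ((σ + closeRoots v a q • γ c : Γ) : WithTop Γ) := by
  obtain ⟨σ, hσ⟩ := ha.exists_eventually_prod hγ (q.aroots Ω)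
  obtain ⟨ρ, hρ⟩ := WithTop.ne_top_iff_exists.1
    (ne_top_iff (v := v).2 (algebraMap_leadingCoeff_ne_zero (Ω := Ω) hq))
  refine ⟨ρ + σ, ?_⟩
  filter_upwards [hσ] with c hc
  rw [aeval_eq_prod_aroots, v.map_mul, hc, ← hρ, ← WithTop.coe_add, add_assoc]
  rfl

/-- Two affine functions of `v (a - c)` with distinct slopes are eventually distinct. -/
theorem NoMax.eventually_affine_ne (ha : NoMax F v a) {γ : F → Γ}
    (hγ : ∀ c, v (a - algebraMap F Ω c) = γ c) (σ τ : Γ) {n k : ℕ} (hnk : n < k) :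
    ∀ᶠ c in approx F v a, σ + n • γ c ≠ τ + k • γ c := by
  by_cases h : ∃ c₀, σ + n • γ c₀ = τ + k • γ c₀
  · obtain ⟨c₀, h₀⟩ := h
    filter_upwards [ha.eventually_lt c₀] with c hc h
    rw [hγ, hγ, WithTop.coe_lt_coe] at hc
    obtain ⟨j, rfl⟩ := Nat.exists_eq_add_of_lt hnk
    have h1 : ∀ x : Γ, (n + j + 1) • x = n • x + (j + 1) • x := fun x => by
      rw [add_assoc, add_smul]
    rw [h1] at h h₀
    have h2 : (j + 1) • γ c = σ - τ := by
      have : σ + n • γ c - (τ + n • γ c) = (j + 1) • γ c := by rw [h]; abel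
      rw [← this]; abel
    have h3 : (j + 1) • γ c₀ = σ - τ := by
      have : σ + n • γ c₀ - (τ + n • γ c₀) = (j + 1) • γ c₀ := by rw [h₀]; abel
      rw [← this]; abel
    -- An equality at `c` determines `(j + 1) • γ c`, so it cannot recur once `γ c` has increased.
    exact (nsmul_lt_nsmul_right (Nat.succ_ne_zero j) hc).ne (h3.trans h2.symm)
  · push Not at h
    exact Eventually.of_forall h

/-- If `h` has the minimal degree among the polynomials with a close root, the number of close roots
of every polynomial is bounded by that of the power of `h` of the same degree. -/
theorem NoMax.closeRoots_le [IsAlgClosed Ω] (ha : NoMax F v a) {h : F[X]} (h0 : h.Monic)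
    (hk : 0 < closeRoots v a h)
    (hmin : ∀ q : F[X], q ≠ 0 → q.natDegree < h.natDegree → closeRoots v a q = 0)
    (q : F[X]) (hq : q ≠ 0) :
    closeRoots v a q ≤ closeRoots v a h * (q.natDegree / h.natDegree) := by
  obtain ⟨γ, hγ⟩ := ha.exists_coe
  induction hn : q.natDegree using Nat.strong_induction_on generalizing q with
  | _ n ih =>
    subst hn
    rcases lt_or_ge q.natDegree h.natDegree with hlt | hge
    · simp [hmin q hq hlt]
    · have hd : 0 < h.natDegree := by
        refine Nat.pos_of_ne_zero fun h1 => ?_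
        rw [h0.natDegree_eq_zero.1 h1] at hk
        simp [closeRoots, closeCount] at hk
      have hsdeg : (q /ₘ h).natDegree = q.natDegree - h.natDegree := natDegree_divByMonic q h0
      have hs0 : q /ₘ h ≠ 0 := by
        rw [Ne, divByMonic_eq_zero_iff h0, not_lt]
        rw [degree_eq_natDegree h0.ne_zero, degree_eq_natDegree hq]
        exact_mod_cast hge
      have hs := ih _ (by rw [hsdeg]; omega) (q /ₘ h) hs0 rfl
      have hdiv : q.natDegree / h.natDegree = (q /ₘ h).natDegree / h.natDegree + 1 := by
        rw [hsdeg, Nat.div_eq_sub_div hd hge]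
      have hsh0 : h * (q /ₘ h) ≠ 0 := mul_ne_zero h0.ne_zero hs0
      -- The remainder has slope `0` and `h * (q /ₘ h)` has positive slope. If `q` had a larger
      -- slope still, the values of the three terms of `q = r + h * s` would eventually be pairwise
      -- distinct, which the ultrametric law forbids.
      have hmain : closeRoots v a q ≤ closeRoots v a (h * (q /ₘ h)) := by
        by_contra! hlt
        have heq := modByMonic_add_div q h
        by_cases hr0 : q %ₘ h = 0
        · rw [hr0, zero_add] at heq
          rw [heq] at hlt
          exact hlt.ne rfl
        · have hr1 : closeRoots v a (q %ₘ h) = 0 :=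
            hmin _ hr0 (natDegree_modByMonic_lt q h0 (by
              rintro rfl
              simp at hd))
          obtain ⟨σ, hσ⟩ := ha.exists_eventually_aeval hγ hq
          obtain ⟨τ, hτ⟩ := ha.exists_eventually_aeval hγ hsh0
          obtain ⟨ρ, hρ⟩ := ha.exists_eventually_aeval hγ hr0
          have hpos : 0 < closeRoots v a (h * (q /ₘ h)) := by
            rw [closeRoots_mul hsh0]; omega
          obtain ⟨c, h1, h2, h3, h4, h5, h6⟩ := (hσ.and (hτ.and (hρ.and
            ((ha.eventually_affine_ne hγ τ σ hlt).and
              ((ha.eventually_affine_ne hγ ρ τ hpos).and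
                (ha.eventually_affine_ne hγ ρ σ (hpos.trans hlt))))))).exists
          rw [hr1] at h3
          have h7 : v (aeval (algebraMap F Ω c) (q %ₘ h)) ≠
              v (aeval (algebraMap F Ω c) (h * (q /ₘ h))) := by
            rw [h2, h3]
            exact_mod_cast h5
          have h8 := v.map_add_of_distinct_val h7
          rw [← map_add, heq, h1, h2, h3] at h8
          rcases min_choice ((ρ + 0 • γ c : Γ) : WithTop Γ)
            ((τ + closeRoots v a (h * (q /ₘ h)) • γ c : Γ) : WithTop Γ) with h9 | h9
          · rw [h9] at h8
            exact h6 (by exact_mod_cast h8.symm)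
          · rw [h9] at h8
            exact h4 (by exact_mod_cast h8.symm)
      rw [closeRoots_mul hsh0] at hmain
      rw [hdiv, mul_add, mul_one]
      omega

/-- If `aᵖ ∈ F`, then the polynomials over `F` of degree less than `p` have no roots close to
`a`. -/
theorem NoMax.not_isClose [IsAlgClosed Ω] (ha : NoMax F v a) {p : ℕ} [hp : Fact p.Prime]
    [CharP F p] {A : F} (hA : a ^ p = algebraMap F Ω A) {q : F[X]} (hq : q ≠ 0)
    (hdeg : q.natDegree < p) {r : Ω} (hr : aeval r q = 0) : ¬ IsClose F v a r := by
  intro hclose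
  have hex : ∃ n, ∃ h : F[X], h.natDegree = n ∧ h ≠ 0 ∧ 0 < closeRoots v a h :=
    ⟨_, q, rfl, hq, closeCount_pos ((mem_aroots.2 ⟨hq, hr⟩)) hclose⟩
  classical
  obtain ⟨h, hhn, hh0, hhk⟩ := Nat.find_spec hex
  have hle : Nat.find hex ≤ q.natDegree :=
    Nat.find_min' hex ⟨q, rfl, hq, closeCount_pos ((mem_aroots.2 ⟨hq, hr⟩)) hclose⟩
  have hmin : ∀ q : F[X], q ≠ 0 → q.natDegree < h.natDegree → closeRoots v a q = 0 := by
    intro q hq hlt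
    by_contra hne
    exact Nat.find_min hex (hhn ▸ hlt) ⟨q, rfl, hq, Nat.pos_of_ne_zero hne⟩
  rw [← hhn] at hle
  have hc0 : C h.leadingCoeff⁻¹ ≠ 0 := by simpa using hh0
  set g : F[X] := h * C h.leadingCoeff⁻¹ with hg
  have hgm : g.Monic := monic_mul_leadingCoeff_inv hh0
  have hgd : g.natDegree = h.natDegree := natDegree_mul_leadingCoeff_inv h hh0
  have hgk : closeRoots v a g = closeRoots v a h := by
    rw [hg, closeRoots_mul (mul_ne_zero hh0 hc0)]
    simp [closeRoots, closeCount]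
  have hXp0 : (X ^ p - C A : F[X]) ≠ 0 := X_pow_sub_C_ne_zero hp.out.pos A
  have hchar : CharP Ω p := charP_of_injective_algebraMap (algebraMap F Ω).injective p
  -- In characteristic `p` this polynomial is `(X - a)ᵖ`, so all of its `p` roots are close.
  have hXp : closeRoots v a (X ^ p - C A : F[X]) = p := by
    have : (X ^ p - C A : F[X]).aroots Ω = Multiset.replicate p a := by
      have : (X ^ p - C A : F[X]).map (algebraMap F Ω) = (X - C a) ^ p := by
        rw [sub_pow_char, ← C_pow, hA]
        simp
      rw [aroots, this, roots_pow, roots_X_sub_C, Multiset.nsmul_singleton]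
    classical
    rw [closeRoots, this, closeCount, Multiset.countP_eq_card.2 (fun r hr => ?_),
      Multiset.card_replicate]
    rw [Multiset.eq_of_mem_replicate hr]
    exact ha.isClose_self
  -- With `d` the minimal degree and `k ≤ d` the number of close roots of `h`, this reads `p ≤ k *
  -- (p / d) ≤ d * (p / d) ≤ p`, so `d` divides `p`.
  have hb := ha.closeRoots_le hgm (hgk ▸ hhk) (hgd ▸ hmin) _ hXp0
  rw [hXp, natDegree_X_pow_sub_C, hgk, hgd] at hb
  have hkd : closeRoots v a h ≤ h.natDegree :=
    (closeCount_le_card _).trans (card_roots_map_le_natDegree h)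
  have hdvd : h.natDegree ∣ p := by
    refine ⟨p / h.natDegree, le_antisymm (hb.trans (Nat.mul_le_mul_right _ hkd)) ?_⟩
    exact Nat.mul_div_le _ _
  rcases (Nat.dvd_prime hp.out).1 hdvd with hd | hd
  -- A linear polynomial has its root in `F`, and an element of `F` is not closer to `a` than
  -- itself.
  · rw [hd] at hkd
    obtain ⟨r, hr, hrc⟩ := by
      classical
      exact Multiset.countP_pos.1 hhk
    rw [mem_aroots] at hr
    rw [eq_X_add_C_of_natDegree_le_one hd.le] at hr
    have h1 : h.coeff 1 ≠ 0 := by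
      rw [← hd]; simpa using hh0
    have h1' : algebraMap F Ω (h.coeff 1) ≠ 0 := by simpa using h1
    have h2 := hr.2
    simp only [map_add, map_mul, aeval_C, aeval_X] at h2
    have h3 : r = algebraMap F Ω (-h.coeff 0 / h.coeff 1) := by
      rw [map_div₀, map_neg, eq_div_iff h1']
      linear_combination h2
    have := hrc (-h.coeff 0 / h.coeff 1)
    rw [← h3] at this
    exact this.false
  · omega

end CloseRoots

/-! ### Simple extensions of degree `p`: approximation of elements and comparison of generators. -/

section Comparison

variable {F Ω Γ : Type*} [Field F] [Field Ω] [Algebra F Ω]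
  [AddCommGroup Γ] [LinearOrder Γ] [IsOrderedAddMonoid Γ]
  {v : AddValuation Ω (WithTop Γ)} {a : Ω}

/-- Each quotient `(c - r) / (a - r)` is eventually congruent to `1` modulo the maximal ideal, hence
so is their product. -/
theorem NoMax.eventually_lt_prod_sub (ha : NoMax F v a) {s : Multiset Ω}
    (hs : ∀ r ∈ s, ¬ IsClose F v a r) :
    ∀ᶠ c in approx F v a, v (s.map (a - ·)).prod <
      v ((s.map (algebraMap F Ω c - ·)).prod - (s.map (a - ·)).prod) := by
  induction s using Multiset.induction_on with
  | empty => simp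
  | cons r s ih =>
    have ih := ih fun x hx => hs x (Multiset.mem_cons_of_mem hx)
    have hr := ha.eventually_lt_of_not_isClose (hs r (Multiset.mem_cons_self r s))
    filter_upwards [ih, hr] with c hc hrc
    rw [Multiset.map_cons, Multiset.prod_cons, Multiset.map_cons, Multiset.prod_cons]
    set P := (s.map (a - ·)).prod
    set Q := (s.map (algebraMap F Ω c - ·)).prod
    have h : (algebraMap F Ω c - r) * Q - (a - r) * P =
        (algebraMap F Ω c - r) * (Q - P) + (algebraMap F Ω c - a) * P := by ring
    rw [h]
    refine v.map_lt_add ?_ ?_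
    · rw [v.map_mul, v.map_mul, map_sub_eq_of_lt hrc]
      exact WithTop.add_lt_add_left hrc.ne_top hc
    · rw [v.map_mul, v.map_mul, v.map_sub_swap _ a]
      exact WithTop.add_lt_add_right hc.ne_top hrc

/-- The logarithmic derivative at `a` is the sum of the `1 / (a - r)`, and eventually every `v(a -
r)` is less than `v(a - c)`. -/
theorem NoMax.eventually_le_derivative_prod (ha : NoMax F v a) {s : Multiset Ω}
    (hs : ∀ r ∈ s, ¬ IsClose F v a r) :
    ∀ᶠ c in approx F v a, v (eval a (s.map (X - C ·)).prod) ≤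
      v (eval a (derivative (s.map (X - C ·)).prod)) + v (a - algebraMap F Ω c) := by
  induction s using Multiset.induction_on with
  | empty => simp
  | cons r s ih =>
    have ih := ih fun x hx => hs x (Multiset.mem_cons_of_mem hx)
    have hr := ha.eventually_lt_of_not_isClose (hs r (Multiset.mem_cons_self r s))
    filter_upwards [ih, hr] with c hc hrc
    rw [Multiset.map_cons, Multiset.prod_cons]
    set P := (s.map (X - C ·)).prod
    have h : eval a (derivative ((X - C r) * P)) = eval a P + (a - r) * eval a (derivative P) := by
      simp
    have h' : eval a ((X - C r) * P) = (a - r) * eval a P := by simp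
    obtain ⟨e, he⟩ : ∃ e, e = a - algebraMap F Ω c := ⟨_, rfl⟩
    rw [h, h', ← v.map_mul, ← he, add_mul]
    rw [← he] at hc hrc
    refine v.map_le_add ?_ ?_
    · rw [mul_comm, v.map_mul, v.map_mul]
      gcongr
    · rw [mul_assoc, v.map_mul, v.map_mul, v.map_mul]
      gcongr

theorem isIntegral_of_pow_eq {p : ℕ} (hp : p ≠ 0) {A : F} (hA : a ^ p = algebraMap F Ω A) :
    IsIntegral F a :=
  ⟨X ^ p - C A, monic_X_pow_sub_C A hp, by simp [hA]⟩

/-- Every polynomial expression in `a` can be written with a polynomial of degree less than `p`. -/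
theorem exists_aeval_of_mem_adjoin {p : ℕ} (hp : p ≠ 0) {A : F} (hA : a ^ p = algebraMap F Ω A)
    {x : Ω} (hx : x ∈ IntermediateField.adjoin F {a}) :
    ∃ q : F[X], q.natDegree < p ∧ x = aeval a q := by
  rw [← IntermediateField.mem_toSubalgebra,
    IntermediateField.adjoin_simple_toSubalgebra_of_isAlgebraic
      (isIntegral_of_pow_eq hp hA).isAlgebraic, Algebra.adjoin_singleton_eq_range_aeval] at hx
  obtain ⟨q, rfl⟩ := hx
  have hm : (X ^ p - C A : F[X]).Monic := monic_X_pow_sub_C A hp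
  have hd : (X ^ p - C A : F[X]).natDegree = p := natDegree_X_pow_sub_C
  refine ⟨q %ₘ (X ^ p - C A), ?_, ?_⟩
  · refine (natDegree_modByMonic_lt q hm fun h => hp ?_).trans_eq hd
    rw [← hd, h, natDegree_one]
  · exact (aeval_modByMonic_eq_self_of_root (by simp [hA])).symm

variable [IsAlgClosed Ω] {p : ℕ} [hp : Fact p.Prime] [CharP F p] {A : F}

theorem NoMax.eventually_lt_aeval_sub (ha : NoMax F v a) (hA : a ^ p = algebraMap F Ω A)
    {q : F[X]} (hq : q ≠ 0) (hdeg : q.natDegree < p) :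
    ∀ᶠ c in approx F v a, v (aeval a q) < v (aeval (algebraMap F Ω c) q - aeval a q) := by
  filter_upwards [ha.eventually_lt_prod_sub (s := q.aroots Ω) fun r hr =>
    ha.not_isClose hA hq hdeg (mem_aroots.1 hr).2] with c hc
  rw [aeval_eq_prod_aroots, aeval_eq_prod_aroots, ← mul_sub, v.map_mul, v.map_mul]
  exact WithTop.add_lt_add_left (ne_top_iff.2 (algebraMap_leadingCoeff_ne_zero hq)) hc

theorem NoMax.exists_le_derivative (ha : NoMax F v a) (hA : a ^ p = algebraMap F Ω A)
    {q : F[X]} (hq : q ≠ 0) (hdeg : q.natDegree < p) :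
    ∃ c : F, v (aeval a q) ≤ v (aeval a (derivative q)) + v (a - algebraMap F Ω c) := by
  obtain ⟨c, hc⟩ := (ha.eventually_le_derivative_prod (s := q.aroots Ω) fun r hr =>
    ha.not_isClose hA hq hdeg (mem_aroots.1 hr).2).exists
  refine ⟨c, ?_⟩
  have h := (IsAlgClosed.splits (q.map (algebraMap F Ω))).eq_prod_roots
  rw [leadingCoeff_map] at h
  rw [← eval_map_algebraMap, ← eval_map_algebraMap (derivative q), ← derivative_map, h,
    derivative_C_mul, eval_mul, eval_mul, eval_C, v.map_mul, v.map_mul, add_assoc]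
  gcongr

/-- Since `a` is close to itself, it is not a root of a nonzero polynomial of degree less than `p`.
-/
theorem NoMax.minpoly_eq (ha : NoMax F v a) (hA : a ^ p = algebraMap F Ω A) :
    minpoly F a = X ^ p - C A := by
  have hint := isIntegral_of_pow_eq hp.out.ne_zero hA
  have h1 : minpoly F a ∣ X ^ p - C A := minpoly.dvd F a (by simp [hA])
  have h2 : p ≤ (minpoly F a).natDegree := by
    by_contra! h
    exact ha.not_isClose hA (minpoly.ne_zero hint) h (minpoly.aeval F a) ha.isClose_self
  refine (eq_of_monic_of_dvd_of_natDegree_le (minpoly.monic hint)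
    (monic_X_pow_sub_C A hp.out.ne_zero) h1 ?_).symm
  rwa [natDegree_X_pow_sub_C]

/-- One half of the comparison of the distances of two generators of a purely inseparable extension
of degree `p`. -/
theorem NoMax.exists_le_of_eq_aeval (ha : NoMax F v a) (hA : a ^ p = algebraMap F Ω A) {b : Ω}
    {f : F[X]} (hf : f.natDegree < p) (hb : b = aeval a f) (hbF : ∀ c, b ≠ algebraMap F Ω c)
    (c : F) :
    ∃ c' : F, v (b - algebraMap F Ω c) ≤ v (aeval a (derivative f)) + v (a - algebraMap F Ω c') := by
  have h : b - algebraMap F Ω c = aeval a (f - C c) := by simp [hb]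
  have h0 : f - C c ≠ 0 := by
    intro h0
    rw [h0, map_zero, sub_eq_zero] at h
    exact hbF c h
  -- Subtracting a constant leaves the derivative unchanged, so the same shift serves every `c`.
  obtain ⟨c', hc'⟩ := ha.exists_le_derivative hA h0 (by simpa using hf)
  exact ⟨c', by simpa [h] using hc'⟩

/-- Two generators of a purely inseparable extension of degree `p` have the same distance up to a
shift by the value of an element of the extension. -/
theorem NoMax.exists_shift (ha : NoMax F v a) (hA : a ^ p = algebraMap F Ω A) {b : Ω}
    (hbn : NoMax F v b) {B : F} (hB : b ^ p = algebraMap F Ω B)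
    (hba : b ∈ IntermediateField.adjoin F {a}) (hab : a ∈ IntermediateField.adjoin F {b}) :
    ∃ d ∈ IntermediateField.adjoin F {a}, d ≠ 0 ∧
      (∀ c : F, ∃ c' : F, v (b - algebraMap F Ω c) ≤ v d + v (a - algebraMap F Ω c')) ∧
      ∀ c : F, ∃ c' : F, v d + v (a - algebraMap F Ω c) ≤ v (b - algebraMap F Ω c') := by
  obtain ⟨f, hfd, hf⟩ := exists_aeval_of_mem_adjoin hp.out.ne_zero hA hba
  obtain ⟨g, hgd, hg⟩ := exists_aeval_of_mem_adjoin hp.out.ne_zero hB hab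
  have hchain : aeval a (derivative f) * aeval b (derivative g) = 1 := by
    -- Differentiate `g(f(X)) - X = (Xᵖ - A) u` at `a`: the right side vanishes, because `Xᵖ - A`
    -- has derivative zero and root `a`.
    have h1 : minpoly F a ∣ g.comp f - X := minpoly.dvd F a (by
      rw [map_sub, aeval_comp, ← hf, ← hg, aeval_X, sub_self])
    rw [ha.minpoly_eq hA] at h1
    obtain ⟨u, hu⟩ := h1
    have h2 := congrArg (fun q => aeval a (derivative q)) hu
    simp only [derivative_comp, derivative_X, derivative_mul, derivative_X_pow,
      derivative_C, CharP.cast_eq_zero, map_sub, map_mul, map_add, aeval_comp, ← hf, map_one,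
      map_pow, aeval_X, aeval_C, hA, sub_self, zero_mul, map_zero, add_zero] at h2
    linear_combination h2
  have hd0 : aeval a (derivative f) ≠ 0 := left_ne_zero_of_mul_eq_one hchain
  have hne : ∀ {x : Ω}, NoMax F v x → ∀ c, x ≠ algebraMap F Ω c := by
    rintro _ hx c rfl
    exact hx.ne_top c (by simp)
  refine ⟨aeval a (derivative f), ?_, hd0, ha.exists_le_of_eq_aeval hA hfd hf (hne hbn), ?_⟩
  · exact IntermediateField.algebra_adjoin_le_adjoin F _ (aeval_mem_adjoin_singleton F a)
  · intro c
    obtain ⟨c', hc'⟩ := hbn.exists_le_of_eq_aeval hB hgd hg (hne ha) c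
    refine ⟨c', ?_⟩
    calc _ ≤ v (aeval a (derivative f)) +
          (v (aeval b (derivative g)) + v (b - algebraMap F Ω c')) := by gcongr
      _ = _ := by rw [← add_assoc, ← v.map_mul, hchain, v.map_one, zero_add]

theorem NoMax.finrank_adjoin (ha : NoMax F v a) (hA : a ^ p = algebraMap F Ω A) :
    Module.finrank F (IntermediateField.adjoin F {a}) = p := by
  rw [IntermediateField.adjoin.finrank (isIntegral_of_pow_eq hp.out.ne_zero hA),
    ha.minpoly_eq hA, natDegree_X_pow_sub_C]

theorem NoMax.adjoin_eq_of_mem (ha : NoMax F v a) (hA : a ^ p = algebraMap F Ω A) {b : Ω}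
    (hbn : NoMax F v b) {B : F} (hB : b ^ p = algebraMap F Ω B)
    (hba : b ∈ IntermediateField.adjoin F {a}) :
    IntermediateField.adjoin F {b} = IntermediateField.adjoin F {a} := by
  have := IntermediateField.adjoin.finiteDimensional (isIntegral_of_pow_eq hp.out.ne_zero hA)
  refine IntermediateField.eq_of_le_of_finrank_eq
    (IntermediateField.adjoin_simple_le_iff.2 hba) ?_
  rw [ha.finrank_adjoin hA, hbn.finrank_adjoin hB]

end Comparison

open scoped Pointwise

/-! ### Immediate extensions as an approximation property, and equality of distances. -/

section Immediate

variable {K Ω Γ : Type*} [Field K] [Field Ω] [Algebra K Ω]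
  [AddCommGroup Γ] [LinearOrder Γ] [IsOrderedAddMonoid Γ]
  {v : AddValuation Ω (WithTop Γ)} {E L M : IntermediateField K Ω}

theorem mem_valuationSubring_iff {x : Ω} :
    x ∈ (AddValuation.toValuation v).valuationSubring ↔ 0 ≤ v x :=
  Iff.rfl

theorem residue_eq_residue_iff (x y : (AddValuation.toValuation v).valuationSubring) :
    IsLocalRing.residue _ x = IsLocalRing.residue _ y ↔ 0 < v ((x : Ω) - y) := by
  rw [← sub_eq_zero, ← map_sub, IsLocalRing.residue_eq_zero_iff]
  exact (AddValuation.toValuation v).mem_maximalIdeal_iff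

/-- Every nonzero element of `L` can be approximated by an element of `E` beyond its value. -/
def Approximates (v : AddValuation Ω (WithTop Γ)) (E L : IntermediateField K Ω) : Prop :=
  ∀ x ∈ L, x ≠ 0 → ∃ z ∈ E, v x < v (x - z)

theorem map_eq_of_lt_map_sub {x z : Ω} (h : v x < v (x - z)) : v z = v x := by
  rw [v.map_sub_swap] at h
  exact v.map_eq_of_lt_sub h

theorem exists_map_eq_coe {x : Ω} (hx : x ≠ 0) : ∃ γ : Γ, v x = γ := by
  obtain ⟨γ, hγ⟩ := WithTop.ne_top_iff_exists.1 (ne_top_iff (v := v).2 hx)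
  exact ⟨γ, hγ.symm⟩

/-- The approximation property composes along towers, hence its use in place of immediacy. To
approximate `x`, divide it by some `y ∈ E` of the same value and lift the residue of `x / y` to `E`.
-/
theorem approximates_iff (h : E ≤ L) :
    Approximates v E L ↔
      valueGroup v L = valueGroup v E ∧ residueSubfield v L = residueSubfield v E := by
  constructor
  · intro hA
    constructor
    · refine le_antisymm ?_ fun γ ⟨x, hx, hγ⟩ => ⟨x, h hx, hγ⟩
      rintro γ ⟨x, hx, hγ⟩
      have hx0 : x ≠ 0 := by rintro rfl; simp at hγ
      obtain ⟨z, hz, hxz⟩ := hA x hx hx0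
      exact ⟨z, hz, (map_eq_of_lt_map_sub hxz).trans hγ⟩
    · refine le_antisymm ?_ fun γ ⟨x, hx, hγ⟩ => ⟨x, h hx, hγ⟩
      rintro _ ⟨x, hx, rfl⟩
      by_cases hx0 : (x : Ω) = 0
      · exact ⟨x, by rw [hx0]; exact E.zero_mem, rfl⟩
      · obtain ⟨z, hz, hxz⟩ := hA x hx hx0
        have h0 : 0 ≤ v (x : Ω) := x.2
        refine ⟨⟨z, mem_valuationSubring_iff.2 (h0.trans_eq (map_eq_of_lt_map_sub hxz).symm)⟩,
          hz, ?_⟩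
        rw [eq_comm, residue_eq_residue_iff]
        exact h0.trans_lt hxz
  · rintro ⟨hv, hr⟩ x hx hx0
    obtain ⟨γ, hγ⟩ := exists_map_eq_coe (v := v) hx0
    obtain ⟨y, hy, hyγ⟩ : γ ∈ valueGroup v E := hv ▸ ⟨x, hx, hγ⟩
    have hy0 : y ≠ 0 := by rintro rfl; simp at hyγ
    have hxy : v (x / y) = 0 := by
      have h1 : v (x / y * y) = γ := by rw [div_mul_cancel₀ _ hy0, hγ]
      rw [v.map_mul, hyγ] at h1
      obtain ⟨δ, hδ⟩ := exists_map_eq_coe (v := v) (div_ne_zero hx0 hy0)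
      rw [hδ] at h1 ⊢
      norm_cast at h1 ⊢
      simpa using h1
    obtain ⟨z, hz, hzr⟩ : IsLocalRing.residue _
        (⟨x / y, mem_valuationSubring_iff.2 hxy.ge⟩ :
          (AddValuation.toValuation v).valuationSubring) ∈ residueSubfield v E :=
      hr ▸ ⟨_, L.div_mem hx (h hy), rfl⟩
    rw [eq_comm, residue_eq_residue_iff] at hzr
    refine ⟨y * z, E.mul_mem hy hz, ?_⟩
    have h2 : x - y * z = y * (x / y - z) := by field_simp
    rw [h2, v.map_mul, hyγ, hγ]
    have := WithTop.add_lt_add_left (WithTop.coe_ne_top (a := γ)) hzr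
    simpa using this

theorem isImmediate_iff : IsImmediate v E ↔ Approximates v ⊥ E :=
  (approximates_iff bot_le).symm

theorem Approximates.mono_left (h : Approximates v E L) (hM : E ≤ M) : Approximates v M L :=
  fun x hx hx0 => (h x hx hx0).imp fun _ hz => ⟨hM hz.1, hz.2⟩

theorem Approximates.trans (h : Approximates v E L) (h' : Approximates v L M) :
    Approximates v E M := by
  intro x hx hx0
  obtain ⟨z, hz, hxz⟩ := h' x hx hx0
  have hz0 : z ≠ 0 := by
    rintro rfl
    simp at hxz
  obtain ⟨w, hw, hzw⟩ := h z hz hz0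
  refine ⟨w, hw, ?_⟩
  rw [← sub_add_sub_cancel x z w]
  exact v.map_lt_add hxz ((map_eq_of_lt_map_sub hxz).symm.trans_lt hzw)

theorem Approximates.noMax (h : Approximates v E L) (hE : E ≤ L) {b : Ω} (hb : b ∈ L)
    (hbE : b ∉ E) : NoMax E v b := by
  intro c
  obtain ⟨z, hz, hlt⟩ := h (b - c) (L.sub_mem hb (hE c.2)) (by
    rw [sub_ne_zero]
    rintro rfl
    exact hbE c.2)
  exact ⟨c + ⟨z, hz⟩, by simpa [sub_sub] using hlt⟩

theorem isWeaklyImmediate_iff {b : Ω} : IsWeaklyImmediate K v b ↔ NoMax K v b := by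
  constructor
  · intro h c
    by_contra! hc
    refine h ⟨v (b - algebraMap K Ω c), ⟨c, rfl⟩, ?_⟩
    rintro _ ⟨c', rfl⟩
    exact hc c'
  · rintro h ⟨_, ⟨c, rfl⟩, hc⟩
    obtain ⟨c', hc'⟩ := h c
    exact (hc ⟨c', rfl⟩).not_gt hc'

theorem NoMax.not_mem_bot {b : Ω} (hb : NoMax K v b) : b ∉ (⊥ : IntermediateField K Ω) := by
  intro h
  obtain ⟨c, rfl⟩ := IntermediateField.mem_bot.1 h
  exact hb.ne_top c (by simp)

/-- Guarantees that restricting to the divisible hull in `dist` discards no finite value of `v(b -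
K)` when `b ∈ K^{1/p}`. -/
theorem mem_divHull {p : ℕ} [hp : Fact p.Prime] [CharP K p] {x : Ω} (hx : x ∈ pthRoots K Ω p)
    {γ : Γ} (hγ : v x = γ) : γ ∈ divHull K v := by
  obtain ⟨c, hc⟩ := hx
  refine ⟨p, hp.out.pos, algebraMap K Ω c, IntermediateField.algebraMap_mem _ c, ?_⟩
  rw [← hc, v.map_pow, hγ, WithTop.coe_nsmul]

theorem mem_dist_iff {b : Ω} {x : divHull K v} :
    x ∈ dist K v b ↔ ∃ γ : divHull K v,
      (∃ c : K, v (b - algebraMap K Ω c) = ((γ : Γ) : WithTop Γ)) ∧ x ≤ γ :=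
  mem_lowerClosure

theorem mem_vadd_iff {D : LowerSet (divHull K v)} {α x : divHull K v} :
    x ∈ α +ᵥ D ↔ x - α ∈ D := by
  have : x ∈ α +ᵥ (D : Set (divHull K v)) ↔ x - α ∈ D := by
    rw [Set.mem_vadd_set_iff_neg_vadd_mem, vadd_eq_add, neg_add_eq_sub]
    rfl
  exact this

/-- Mutual cofinality, up to a shift, of `v(b - K)` and `v(b' - K)` implies that the distances are
equal modulo `vK`. -/
theorem distEqMod_of_cofinal {p : ℕ} [hp : Fact p.Prime] [CharP K p] {b b' : Ω}
    (hb : b ∈ pthRoots K Ω p) (hb' : b' ∈ pthRoots K Ω p) (hbn : NoMax K v b)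
    (hbn' : NoMax K v b') {α : Γ} (hα : α ∈ valueGroup v (⊥ : IntermediateField K Ω))
    (h₁ : ∀ c : K, ∃ c' : K, v (b - algebraMap K Ω c) ≤ α + v (b' - algebraMap K Ω c'))
    (h₂ : ∀ c : K, ∃ c' : K, α + v (b' - algebraMap K Ω c) ≤ v (b - algebraMap K Ω c')) :
    DistEqMod K v b b' := by
  have hαd : α ∈ divHull K v := ⟨1, one_pos, by simpa using hα⟩
  have key : ∀ {y : Ω}, y ∈ pthRoots K Ω p → NoMax K v y → ∀ c : K,
      ∃ γ : divHull K v, v (y - algebraMap K Ω c) = ((γ : Γ) : WithTop Γ) := by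
    intro y hy hyn c
    obtain ⟨γ, hγ⟩ := WithTop.ne_top_iff_exists.1 (hyn.ne_top c)
    exact ⟨⟨γ, mem_divHull (sub_mem hy (IntermediateField.algebraMap_mem _ c)) hγ.symm⟩, hγ.symm⟩
  refine ⟨⟨α, hαd⟩, hα, ?_⟩
  ext x
  rw [SetLike.mem_coe, SetLike.mem_coe, mem_vadd_iff, mem_dist_iff, mem_dist_iff]
  constructor
  · rintro ⟨γ, ⟨c, hc⟩, hx⟩
    obtain ⟨c', hc'⟩ := h₁ c
    obtain ⟨γ', hγ'⟩ := key hb' hbn' c'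
    refine ⟨γ', ⟨c', hγ'⟩, ?_⟩
    rw [hc, hγ', ← WithTop.coe_add, WithTop.coe_le_coe] at hc'
    rw [sub_le_iff_le_add']
    exact hx.trans hc'
  · rintro ⟨γ, ⟨c, hc⟩, hx⟩
    obtain ⟨c', hc'⟩ := h₂ c
    obtain ⟨γ', hγ'⟩ := key hb hbn c'
    refine ⟨γ', ⟨c', hγ'⟩, ?_⟩
    rw [hc, hγ', ← WithTop.coe_add, WithTop.coe_le_coe] at hc'
    rw [sub_le_iff_le_add'] at hx
    exact hx.trans hc'

theorem DistEqMod.trans {a b c : Ω} (h : DistEqMod K v a b) (h' : DistEqMod K v b c) :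
    DistEqMod K v a c := by
  obtain ⟨α, hα, h⟩ := h
  obtain ⟨β, hβ, h'⟩ := h'
  exact ⟨α + β, add_mem hα hβ, by rw [h, h', add_vadd]⟩

theorem IsClose.noMax {b e : Ω} (h : IsClose K v b e) (hb : NoMax K v b) : NoMax K v e := by
  intro c
  obtain ⟨c', hc'⟩ := hb c
  exact ⟨c', by rwa [v.map_sub_swap, h.map_sub, v.map_sub_swap e, h.map_sub]⟩

/-- For every `c ∈ K` the elements `b - c` and `e - c` have the same value, so the shift is `0`. -/
theorem IsClose.distEqMod {p : ℕ} [hp : Fact p.Prime] [CharP K p] {b e : Ω}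
    (h : IsClose K v b e) (hb : b ∈ pthRoots K Ω p) (he : e ∈ pthRoots K Ω p)
    (hbn : NoMax K v b) : DistEqMod K v b e := by
  refine distEqMod_of_cofinal hb he hbn (h.noMax hbn) (zero_mem _) (fun c => ⟨c, ?_⟩)
    fun c => ⟨c, ?_⟩ <;>
  rw [WithTop.coe_zero, zero_add, v.map_sub_swap e, h.map_sub]

end Immediate

/-! ### Counting distances along a tower of steps of degree `p`. -/

section Tower

variable {K Ω Γ : Type*} [Field K] [Field Ω] [Algebra K Ω]
  [AddCommGroup Γ] [LinearOrder Γ] [IsOrderedAddMonoid Γ]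
  {v : AddValuation Ω (WithTop Γ)} {p : ℕ} [hp : Fact p.Prime] [CharP K p]

theorem exists_pow_eq {x : Ω} (hx : x ∈ pthRoots K Ω p) (E : IntermediateField K Ω) :
    ∃ A : E, x ^ p = algebraMap E Ω A := by
  obtain ⟨c, hc⟩ := hx
  exact ⟨algebraMap K E c, hc⟩

omit hp in
theorem charP_intermediateField (E : IntermediateField K Ω) : CharP E p :=
  charP_of_injective_algebraMap (algebraMap K E).injective p

/-- The field `E(x)` as an extension of `K`. -/
abbrev adjoinOver (E : IntermediateField K Ω) (x : Ω) : IntermediateField K Ω :=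
  (IntermediateField.adjoin E {x}).restrictScalars K

theorem le_adjoinOver (E : IntermediateField K Ω) (x : Ω) : E ≤ adjoinOver E x :=
  fun y hy => (IntermediateField.adjoin E {x}).algebraMap_mem ⟨y, hy⟩

theorem mem_adjoinOver (E : IntermediateField K Ω) (x : Ω) : x ∈ adjoinOver E x :=
  IntermediateField.mem_adjoin_simple_self E x

theorem adjoinOver_le {E M : IntermediateField K Ω} {x : Ω} (hE : E ≤ M) (hx : x ∈ M) :
    adjoinOver E x ≤ M := by
  have : IntermediateField.adjoin E {x} ≤ IntermediateField.extendScalars hE :=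
    IntermediateField.adjoin_simple_le_iff.2 hx
  exact fun y hy => this hy

variable [IsAlgClosed Ω]

/-- If `v(b - E)` has no maximum and `bᵖ ∈ K`, then `E(b)|E` is immediate. -/
theorem NoMax.approximates_adjoinOver {E : IntermediateField K Ω} {b : Ω} (hb : NoMax E v b)
    (hbp : b ∈ pthRoots K Ω p) : Approximates v E (adjoinOver E b) := by
  intro x hx hx0
  have := charP_intermediateField (p := p) E
  obtain ⟨A, hA⟩ := exists_pow_eq hbp E
  obtain ⟨q, hqd, rfl⟩ := exists_aeval_of_mem_adjoin hp.out.ne_zero hA hx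
  have hq0 : q ≠ 0 := by
    rintro rfl
    simp at hx0
  obtain ⟨c, hc⟩ := (hb.eventually_lt_aeval_sub hA hq0 hqd).exists
  refine ⟨aeval (algebraMap E Ω c) q, ?_, by rwa [v.map_sub_swap]⟩
  rw [aeval_algebraMap_apply]
  exact (aeval c q).2

/-- Every distance of an element of `K^{1/p}` that is weakly immediate over `K` is already the
distance of an element of a maximal immediate subextension. -/
theorem exists_distEqMod_of_maximal {E : IntermediateField K Ω}
    (hE : Maximal (fun E : IntermediateField K Ω => E ≤ pthRoots K Ω p ∧ IsImmediate v E) E)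
    {b : Ω} (hb : b ∈ pthRoots K Ω p) (hbn : NoMax K v b) :
    ∃ e ∈ E, NoMax K v e ∧ DistEqMod K v b e := by
  by_cases h : ∃ e ∈ E, IsClose K v b e
  · obtain ⟨e, he, hclose⟩ := h
    exact ⟨e, he, hclose.noMax hbn, hclose.distEqMod hb (hE.prop.1 he) hbn⟩
  · exfalso
    simp only [IsClose] at h
    push Not at h
    have hbE : b ∉ E := by
      intro hbE
      obtain ⟨c, hc⟩ := h b hbE
      rw [sub_self, v.map_zero, top_le_iff] at hc
      exact hbn.ne_top c hc
    -- Here `v(b - K)` is cofinal in `v(b - E)`, so the latter inherits the absence of a maximum.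
    have hbnE : NoMax E v b := by
      intro e
      obtain ⟨c, hc⟩ := h e e.2
      obtain ⟨c', hc'⟩ := hbn c
      exact ⟨algebraMap K E c', hc.trans_lt hc'⟩
    have happ : Approximates v ⊥ (adjoinOver E b) :=
      (isImmediate_iff.1 hE.prop.2).trans (hbnE.approximates_adjoinOver hb)
    have hmem := hE.le_of_ge ⟨adjoinOver_le hE.prop.1 hb, isImmediate_iff.2 happ⟩
      (le_adjoinOver E b) (mem_adjoinOver E b)
    exact hbE hmem

/-- `S` represents all distances in `L` modulo `vK`. -/
def Represents (v : AddValuation Ω (WithTop Γ)) (L : IntermediateField K Ω) (S : Finset Ω) :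
    Prop :=
  (∀ a ∈ S, a ∈ L ∧ NoMax K v a) ∧ ∀ b ∈ L, NoMax K v b → ∃ a ∈ S, DistEqMod K v b a

omit [CharP K p] [IsAlgClosed Ω] hp in
theorem Represents.ndd_le {L : IntermediateField K Ω} {S : Finset Ω} (h : Represents v L S) :
    ndd v L ≤ S.card := by
  refine sInf_le ⟨S.card, rfl, fun i => (S.equivFin.symm i : Ω), fun i => ?_, fun b hb _ hbw => ?_⟩
  · have := h.1 _ (S.equivFin.symm i).2
    exact ⟨this.1, this.2.not_mem_bot, isWeaklyImmediate_iff.2 this.2⟩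
  · obtain ⟨a, ha, hab⟩ := h.2 b hb (isWeaklyImmediate_iff.1 hbw)
    exact ⟨S.equivFin ⟨a, ha⟩, by simpa using hab⟩

/-- A step of degree `p` in an immediate purely inseparable tower adds at most one distance. -/
theorem Represents.exists_adjoinOver {F M : IntermediateField K Ω} (hFM : F ≤ M)
    (hM : M ≤ pthRoots K Ω p) (hMi : Approximates v ⊥ M) {x : Ω} (hx : x ∈ M) (hxF : x ∉ F)
    {S : Finset Ω} (hS : Represents v F S) :
    ∃ S' : Finset Ω, S'.card ≤ S.card + 1 ∧ Represents v (adjoinOver F x) S' := by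
  classical
  have := charP_intermediateField (p := p) F
  have hle : adjoinOver F x ≤ M := adjoinOver_le hFM hx
  have hclose : ∀ b ∈ M, NoMax K v b → (∃ e ∈ F, IsClose K v b e) →
      ∃ a ∈ S, DistEqMod K v b a := by
    rintro b hb hbn ⟨e, he, hbe⟩
    obtain ⟨a, ha, hea⟩ := hS.2 e he (hbe.noMax hbn)
    exact ⟨a, ha, (hbe.distEqMod (hM hb) (hM (hFM he)) hbn).trans hea⟩
  have hself : ∀ b ∈ F, NoMax K v b → ∃ e ∈ F, IsClose K v b e :=
    fun b hb hbn => ⟨b, hb, hbn.isClose_self⟩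
  have hnoMax : ∀ b ∈ M, b ∉ F → NoMax F v b := fun b hb hbF =>
    (hMi.mono_left bot_le).noMax hFM hb hbF
  -- Only elements with no close `e ∈ F` can have a new distance; one of them, `b₀`, will represent
  -- them all.
  by_cases hgood : ∃ b ∈ adjoinOver F x, NoMax K v b ∧ ¬ ∃ e ∈ F, IsClose K v b e
  · obtain ⟨b₀, hb₀, hb₀n, hb₀F⟩ := hgood
    have hb₀F' : b₀ ∉ F := fun h => hb₀F (hself b₀ h hb₀n)
    refine ⟨insert b₀ S, Finset.card_insert_le _ _, ?_, ?_⟩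
    · intro a ha
      rcases Finset.mem_insert.1 ha with rfl | ha
      · exact ⟨hb₀, hb₀n⟩
      · exact ⟨le_adjoinOver F x (hS.1 a ha).1, (hS.1 a ha).2⟩
    · intro b hb hbn
      by_cases hbF : ∃ e ∈ F, IsClose K v b e
      · obtain ⟨a, ha, hab⟩ := hclose b (hle hb) hbn hbF
        exact ⟨a, Finset.mem_insert_of_mem ha, hab⟩
      · refine ⟨b₀, Finset.mem_insert_self _ _, ?_⟩
        have hbF' : b ∉ F := fun h => hbF (hself b h hbn)
        obtain ⟨X, hX⟩ := exists_pow_eq (hM hx) F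
        obtain ⟨A, hA⟩ := exists_pow_eq (hM (hle hb₀)) F
        obtain ⟨B, hB⟩ := exists_pow_eq (hM (hle hb)) F
        have hxn := hnoMax x hx hxF
        have han := hnoMax b₀ (hle hb₀) hb₀F'
        have hbn' := hnoMax b (hle hb) hbF'
        have e₁ := hxn.adjoin_eq_of_mem hX han hA hb₀
        have e₂ := hxn.adjoin_eq_of_mem hX hbn' hB hb
        obtain ⟨d, hd, hd0, h₁, h₂⟩ := han.exists_shift hA hbn' hB (by rw [e₁]; exact hb)
          (by rw [e₂]; exact hb₀)
        rw [e₁] at hd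
        obtain ⟨α, hα⟩ := exists_map_eq_coe (v := v) hd0
        -- The shift is the value of an element of `F(x)`, which lies in `vK` by immediacy.
        have hαK : α ∈ valueGroup v (⊥ : IntermediateField K Ω) := by
          rw [← ((approximates_iff bot_le).1 hMi).1]
          exact ⟨d, hle hd, hα⟩
        simp only [IsClose] at hbF hb₀F
        push Not at hbF hb₀F
        rw [hα] at h₁ h₂
        -- The comparison holds over `F`; it descends to `K` because `v(b - K)` and `v(b₀ - K)` are
        -- cofinal in `v(b - F)` and `v(b₀ - F)`.
        refine distEqMod_of_cofinal (hM (hle hb)) (hM (hle hb₀)) hbn hb₀n hαK ?_ ?_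
        · intro c
          obtain ⟨e, he⟩ := h₁ (algebraMap K F c)
          obtain ⟨c', hc'⟩ := hb₀F e e.2
          refine ⟨c', he.trans ?_⟩
          gcongr
          exact hc'
        · intro c
          obtain ⟨e, he⟩ := h₂ (algebraMap K F c)
          obtain ⟨c', hc'⟩ := hbF e e.2
          exact ⟨c', he.trans hc'⟩
  · push Not at hgood
    refine ⟨S, Nat.le_succ _, fun a ha => ⟨le_adjoinOver F x (hS.1 a ha).1, (hS.1 a ha).2⟩, ?_⟩
    exact fun b hb hbn => hclose b (hle hb) hbn (hgood b hb hbn)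

/-- An immediate subextension of `K^{1/p}` of degree `pᵐ` has at most `m` distances modulo `vK`. -/
theorem exists_represents {M : IntermediateField K Ω} [FiniteDimensional K M]
    (hM : M ≤ pthRoots K Ω p) (hMi : Approximates v ⊥ M) {m : ℕ}
    (hm : Module.finrank K M = p ^ m) :
    ∃ S : Finset Ω, S.card ≤ m ∧ Represents v M S := by
  have key : ∀ n ≤ m, ∃ F ≤ M, Module.finrank K F = p ^ n ∧
      ∃ S : Finset Ω, S.card ≤ n ∧ Represents v F S := by
    intro n hn
    induction n with
    | zero =>
      refine ⟨⊥, bot_le, by simp, ∅, by simp, by simp, fun b hb hbn => ?_⟩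
      exact (hbn.not_mem_bot hb).elim
    | succ n ih =>
      obtain ⟨F, hFM, hF, S, hSn, hS⟩ := ih (Nat.le_of_succ_le hn)
      have hne : ∃ x ∈ M, x ∉ F := by
        by_contra! h
        rw [le_antisymm hFM h, hm] at hF
        have := Nat.pow_right_injective hp.out.two_le hF
        omega
      obtain ⟨x, hx, hxF⟩ := hne
      obtain ⟨S', hS', hrep⟩ := hS.exists_adjoinOver hFM hM hMi hx hxF
      refine ⟨adjoinOver F x, adjoinOver_le hFM hx, ?_, S', by omega, hrep⟩
      have := charP_intermediateField (p := p) F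
      obtain ⟨X, hX⟩ := exists_pow_eq (hM hx) F
      have hdeg := ((hMi.mono_left bot_le).noMax hFM hx hxF).finrank_adjoin hX
      have hmul := Module.finrank_mul_finrank K F (IntermediateField.adjoin F {x})
      rw [hdeg, hF] at hmul
      rw [pow_succ, hmul]
      rfl
  obtain ⟨F, hFM, hF, S, hSm, hS⟩ := key m le_rfl
  rw [IntermediateField.eq_of_le_of_finrank_eq hFM (hF.trans hm.symm)] at hS
  exact ⟨S, hSm, hS⟩

/-- The two infima run over the same set: representatives in `K^{1/p}` can be replaced by elements
of `E` with the same distances modulo `vK`, and representatives for `E` already serve all of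
`K^{1/p}`. -/
theorem ndd_pthRoots_eq {E : IntermediateField K Ω}
    (hE : Maximal (fun E : IntermediateField K Ω => E ≤ pthRoots K Ω p ∧ IsImmediate v E) E) :
    ndd v (pthRoots K Ω p) = ndd v E := by
  refine congrArg sInf (Set.ext fun N => ?_)
  constructor
  · rintro ⟨n, rfl, a, ha, hrep⟩
    choose e heE hen hae using fun i =>
      exists_distEqMod_of_maximal hE (ha i).1 (isWeaklyImmediate_iff.1 (ha i).2.2)
    refine ⟨n, rfl, e, fun i => ⟨heE i, (hen i).not_mem_bot, isWeaklyImmediate_iff.2 (hen i)⟩, ?_⟩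
    intro b hb hbK hbw
    obtain ⟨i, hi⟩ := hrep b (hE.prop.1 hb) hbK hbw
    exact ⟨i, hi.trans (hae i)⟩
  · rintro ⟨n, rfl, a, ha, hrep⟩
    refine ⟨n, rfl, a, fun i => ⟨hE.prop.1 (ha i).1, (ha i).2⟩, ?_⟩
    intro b hb hbK hbw
    obtain ⟨e, he, hen, hbe⟩ :=
      exists_distEqMod_of_maximal hE hb (isWeaklyImmediate_iff.1 hbw)
    obtain ⟨i, hi⟩ := hrep e he hen.not_mem_bot (isWeaklyImmediate_iff.2 hen)
    exact ⟨i, hbe.trans hi⟩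

end Tower

/-! ### The fundamental inequality and the bound by the defect. -/

section Fundamental

variable {K Ω Γ : Type*} [Field K] [Field Ω] [Algebra K Ω]
  [AddCommGroup Γ] [LinearOrder Γ] [IsOrderedAddMonoid Γ]
  {v : AddValuation Ω (WithTop Γ)} {E L : IntermediateField K Ω}

theorem residueSubfield_mono (h : E ≤ L) : residueSubfield v E ≤ residueSubfield v L :=
  fun _ ⟨x, hx, hγ⟩ => ⟨x, h hx, hγ⟩

theorem exists_linearIndependent_of_relfinrank_ne_zero {k : Type*} [Field k] {A B : Subfield k}
    (h : A ≤ B) (h0 : A.relfinrank B ≠ 0) :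
    ∃ b : Fin (A.relfinrank B) → k, (∀ j, b j ∈ B) ∧ LinearIndependent A b := by
  rw [Subfield.relfinrank_eq_finrank_of_le h] at h0 ⊢
  have := Module.finite_of_finrank_pos (Nat.pos_of_ne_zero h0)
  have β := Module.finBasis A (Subfield.extendScalars h)
  exact ⟨fun j => β j, fun j => (β j).2, β.linearIndependent.map'
    (Subfield.extendScalars h).val.toLinearMap (LinearMap.ker_eq_bot.2 Subtype.val_injective)⟩

/-- The value of a linear combination of elements with linearly independent residues is the value of
one of the coefficients. -/
theorem exists_map_sum_eq {ι : Type*} [Fintype ι]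
    {y : ι → (AddValuation.toValuation v).valuationSubring}
    (hy : LinearIndependent (residueSubfield v E) fun j => IsLocalRing.residue _ (y j))
    {g : ι → E} (hg : g ≠ 0) : ∃ j, g j ≠ 0 ∧ v (∑ j, (g j : Ω) * y j) = v (g j : Ω) := by
  obtain ⟨j₁, hj₁⟩ := Function.ne_iff.1 hg
  obtain ⟨j₀, -, hj₀⟩ := Finset.exists_min_image Finset.univ (fun j => v (g j : Ω)) ⟨j₁, by simp⟩
  have hcoe : ∀ {x : E}, (x : Ω) ≠ 0 ↔ x ≠ 0 := by simp
  have h0 : g j₀ ≠ 0 := by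
    rw [← hcoe, ← ne_top_iff (v := v)]
    exact ((hj₀ j₁ (Finset.mem_univ _)).trans_lt (ne_top_iff.2 (hcoe.2 hj₁)).lt_top).ne
  have h0' : (g j₀ : Ω) ≠ 0 := hcoe.2 h0
  have hmul : ∀ x : Ω, v (g j₀ : Ω) + v (x / g j₀) = v x := fun x => by
    rw [← v.map_mul, mul_div_cancel₀ _ h0']
  have hint : ∀ j, (g j : Ω) / g j₀ ∈ (AddValuation.toValuation v).valuationSubring := by
    intro j
    rw [mem_valuationSubring_iff]
    by_contra! hlt
    have := WithTop.add_lt_add_left (ne_top_iff.2 h0' : v (g j₀ : Ω) ≠ ⊤) hlt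
    rw [hmul, add_zero] at this
    exact (hj₀ j (Finset.mem_univ _)).not_gt this
  refine ⟨j₀, h0, ?_⟩
  set t : (AddValuation.toValuation v).valuationSubring := ∑ j, ⟨_, hint j⟩ * y j with ht
  have hsum : ((t : (AddValuation.toValuation v).valuationSubring) : Ω) =
      (∑ j, (g j : Ω) * y j) / g j₀ := by
    rw [ht, Finset.sum_div, AddSubmonoidClass.coe_finsetSum]
    exact Finset.sum_congr rfl fun j _ => by
      rw [MulMemClass.coe_mul]
      ring
  -- After division by a coefficient of minimal value, a positive value of the sum would give a
  -- linear relation between the residues with coefficient `1` at `j₀`.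
  have ht0 : v (t : Ω) = 0 := by
    refine le_antisymm ?_ t.2
    by_contra! hlt
    have hres : IsLocalRing.residue _ t = 0 := by
      rw [← map_zero (IsLocalRing.residue _), residue_eq_residue_iff]
      simpa using hlt
    rw [ht, map_sum] at hres
    have := Fintype.linearIndependent_iff.1 hy
      (fun j => ⟨IsLocalRing.residue _ ⟨_, hint j⟩, ⟨_, hint j⟩, E.div_mem (g j).2 (g j₀).2, rfl⟩)
      (by
        rw [← hres]
        refine Finset.sum_congr rfl fun j _ => ?_
        rw [map_mul]
        rfl) j₀
    have h1 : (⟨_, hint j₀⟩ : (AddValuation.toValuation v).valuationSubring) = 1 :=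
      Subtype.ext (div_self h0')
    rw [Subtype.ext_iff] at this
    simp only [h1, map_one] at this
    exact one_ne_zero this
  rw [← hmul, ← hsum, ht0, add_zero]

/-- A sum of elements whose values are distinct modulo `vE` vanishes only if all of them vanish. -/
theorem eq_zero_of_sum_eq_zero {ι : Type*} [Fintype ι] {z : ι → Ω}
    (hz : ∀ i j, i ≠ j → z i ≠ 0 → z j ≠ 0 → v (z i) ≠ v (z j)) (hsum : ∑ i, z i = 0) (i : ι) :
    z i = 0 := by
  classical
  by_contra hi
  obtain ⟨i₀, -, h₀⟩ := Finset.exists_min_image Finset.univ (fun j => v (z j)) ⟨i, by simp⟩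
  have hi₀ : z i₀ ≠ 0 := by
    rw [← ne_top_iff (v := v)]
    exact ((h₀ i (Finset.mem_univ _)).trans_lt (ne_top_iff.2 hi).lt_top).ne
  have hlt : v (z i₀) < v (∑ j ∈ Finset.univ.erase i₀, z j) := by
    refine v.map_lt_sum (ne_top_iff.2 hi₀) fun j hj => ?_
    by_cases hj0 : z j = 0
    · rw [hj0, v.map_zero]
      exact (ne_top_iff.2 hi₀).lt_top
    · exact (h₀ j (Finset.mem_univ _)).lt_of_ne (hz _ _ (Finset.ne_of_mem_erase hj).symm hi₀ hj0)
  rw [← Finset.add_sum_erase _ _ (Finset.mem_univ i₀)] at hsum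
  rw [eq_neg_of_add_eq_zero_left hsum, v.map_neg] at hlt
  exact hlt.false

/-- The fundamental inequality `(vL : vE) [Lv : Ev] ≤ [L : E]`. -/
theorem relIndex_mul_relfinrank_le (h : E ≤ L) [FiniteDimensional K L] :
    (valueGroup v E).relIndex (valueGroup v L) *
      (residueSubfield v E).relfinrank (residueSubfield v L) ≤ E.relfinrank L := by
  classical
  -- The value `0` of `relIndex` or `relfinrank` encodes an infinite index or degree; the inequality
  -- is then trivial as stated.
  by_cases he : (valueGroup v E).relIndex (valueGroup v L) = 0
  · simp [he]
  by_cases hf : (residueSubfield v E).relfinrank (residueSubfield v L) = 0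
  · simp [hf]
  obtain ⟨β, hβL, hβ⟩ :=
    exists_linearIndependent_of_relfinrank_ne_zero (residueSubfield_mono (v := v) h) hf
  choose y hyL hyβ using hβL
  have hy : LinearIndependent (residueSubfield v E) fun j => IsLocalRing.residue _ (y j) := by
    simpa only [hyβ] using hβ
  let Q := valueGroup v L ⧸ (valueGroup v E).addSubgroupOf (valueGroup v L)
  have : Finite Q := Nat.finite_of_card_ne_zero he
  have : Fintype Q := Fintype.ofFinite Q
  have hQ : ∀ i : Q, ∃ x ∈ L, v x = ((i.out : Γ) : WithTop Γ) := fun i => i.out.2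
  choose x hxL hx using hQ
  -- Products of coset representatives `x i` of the value groups with lifts `y j` of independent
  -- residues are independent over `E`: the `i`-th partial sum has its value in the coset `i`, so
  -- distinct partial sums cannot cancel.
  have hind : LinearIndependent E fun ij : Q × Fin _ =>
      (⟨x ij.1 * y ij.2, L.mul_mem (hxL ij.1) (hyL ij.2)⟩ : IntermediateField.extendScalars h) := by
    rw [Fintype.linearIndependent_iff]
    intro g hg
    have hg' := congrArg (fun w : IntermediateField.extendScalars h => (w : Ω)) hg
    simp only [AddSubmonoidClass.coe_finsetSum] at hg'
    rw [Fintype.sum_prod_type] at hg'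
    have hgs : ∑ i : Q, x i * ∑ j, (g (i, j) : Ω) * y j = 0 := by
      rw [← show _ = (0 : Ω) from hg']
      refine Finset.sum_congr rfl fun i _ => ?_
      rw [Finset.mul_sum]
      refine Finset.sum_congr rfl fun j _ => ?_
      rw [mul_left_comm]
      rfl
    have hval : ∀ i, x i * ∑ j, (g (i, j) : Ω) * y j ≠ 0 → ∃ δ ∈ valueGroup v E,
        v (x i * ∑ j, (g (i, j) : Ω) * y j) = ((i.out + δ : Γ) : WithTop Γ) := by
      intro i hi
      have hgi : (fun j => g (i, j)) ≠ 0 := by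
        intro h0
        refine hi ?_
        rw [Finset.sum_eq_zero, mul_zero]
        intro j _
        rw [show g (i, j) = 0 from congrFun h0 j]
        simp
      obtain ⟨j, hj, hvj⟩ := exists_map_sum_eq hy hgi
      obtain ⟨δ, hδ⟩ := exists_map_eq_coe (v := v) (x := (g (i, j) : Ω)) (by simpa using hj)
      exact ⟨δ, ⟨_, (g (i, j)).2, hδ⟩, by rw [v.map_mul, hvj, hδ, hx, WithTop.coe_add]⟩
    have hzero := eq_zero_of_sum_eq_zero (v := v) (fun i i' hne hi hi' heq => by
      obtain ⟨δ, hδ, h1⟩ := hval i hi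
      obtain ⟨δ', hδ', h2⟩ := hval i' hi'
      rw [h1, h2, WithTop.coe_inj] at heq
      refine hne ?_
      rw [← QuotientAddGroup.out_eq' i, ← QuotientAddGroup.out_eq' i', QuotientAddGroup.eq,
        AddSubgroup.mem_addSubgroupOf]
      have h3 : ((-i.out + i'.out : valueGroup v L) : Γ) = δ - δ' := by
        push_cast
        rw [neg_add_eq_sub, sub_eq_sub_iff_add_eq_add, add_comm δ, ← heq]
      rw [h3]
      exact sub_mem hδ hδ') hgs
    rintro ⟨i, j⟩
    by_contra hij
    have hgi : (fun j => g (i, j)) ≠ 0 := fun h0 => hij (congrFun h0 j)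
    obtain ⟨j', hj', hvj⟩ := exists_map_sum_eq hy hgi
    have hx0 : x i ≠ 0 := by
      rw [← ne_top_iff (v := v), hx]
      exact WithTop.coe_ne_top
    have h4 := (mul_eq_zero.1 (hzero i)).resolve_left hx0
    rw [h4, v.map_zero, eq_comm] at hvj
    exact hj' (by simpa using (AddValuation.top_iff v).1 hvj)
  have hfin : FiniteDimensional K (IntermediateField.extendScalars h) :=
    inferInstanceAs (FiniteDimensional K L)
  have : FiniteDimensional E (IntermediateField.extendScalars h) :=
    Module.Finite.of_restrictScalars_finite K E _
  have hcard := hind.fintype_card_le_finrank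
  rw [Fintype.card_prod, Fintype.card_fin, ← Nat.card_eq_fintype_card] at hcard
  rw [IntermediateField.relfinrank_eq_finrank_of_le h]
  exact hcard

/-- The degree of an immediate subextension of `L|K` of `p`-power degree is bounded by the defect of
`L|K`. -/
theorem le_of_defect_eq {p : ℕ} (hp : 1 < p) (h : E ≤ L) (hE : IsImmediate v E)
    [FiniteDimensional K L] {m s : ℕ} (hm : Module.finrank K E = p ^ m)
    (hs : defect v L = (p : ℚ) ^ s) : m ≤ s := by
  have hineq := relIndex_mul_relfinrank_le (v := v) h
  rw [hE.1, hE.2] at hineq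
  have hmul := IntermediateField.finrank_bot_mul_relfinrank h
  unfold defect at hs
  rw [← Nat.cast_mul] at hs
  set n := (valueGroup v (⊥ : IntermediateField K Ω)).relIndex (valueGroup v L) *
    (residueSubfield v (⊥ : IntermediateField K Ω)).relfinrank (residueSubfield v L)
  -- With `n = 0` the defect would be the default quotient `0`, which is not a power of `p`.
  have hn : n ≠ 0 := by
    intro h0
    rw [h0, Nat.cast_zero, div_zero] at hs
    exact pow_ne_zero s (by positivity) hs.symm
  rw [div_eq_iff (by exact_mod_cast hn)] at hs
  have hs' : Module.finrank K L = p ^ s * n := by exact_mod_cast hs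
  rw [← hmul, hm] at hs'
  have : p ^ m * n ≤ p ^ s * n := hs' ▸ Nat.mul_le_mul_left _ hineq
  exact (Nat.pow_le_pow_iff_right hp).1 (Nat.le_of_mul_le_mul_right this (Nat.pos_of_ne_zero hn))

end Fundamental

end DistanceCount

/-- `Ω` is an algebraic closure of `K`, and `v` is a valuation of `Ω`, i.e. a valuation of `K`
together with a fixed extension to the algebraic closure. -/
theorem proposition4p1 {K Ω Γ : Type*} [Field K] [Field Ω] [Algebra K Ω] [IsAlgClosure K Ω]
    [AddCommGroup Γ] [LinearOrder Γ] [IsOrderedAddMonoid Γ]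
    (p : ℕ) [Fact p.Prime] [CharP K p] (v : AddValuation Ω (WithTop Γ))
    (K' : IntermediateField K Ω)
    (hK' : Maximal (fun E : IntermediateField K Ω =>
      E ≤ DistanceCount.pthRoots K Ω p ∧ DistanceCount.IsImmediate v E) K')
    [FiniteDimensional K K'] (m : ℕ) (hm : Module.finrank K K' = p ^ m) :
    DistanceCount.ndd v (DistanceCount.pthRoots K Ω p) = DistanceCount.ndd v K' ∧
      DistanceCount.ndd v K' ≤ m ∧
      ∀ s : ℕ, FiniteDimensional K (DistanceCount.pthRoots K Ω p) →
        DistanceCount.defect v (DistanceCount.pthRoots K Ω p) = (p : ℚ) ^ s →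
        DistanceCount.ndd v (DistanceCount.pthRoots K Ω p) ≤ s := by
  have : IsAlgClosed Ω := IsAlgClosure.isAlgClosed K
  have himm := DistanceCount.isImmediate_iff.1 hK'.prop.2
  obtain ⟨S, hSm, hS⟩ := DistanceCount.exists_represents hK'.prop.1 himm hm
  have heq := DistanceCount.ndd_pthRoots_eq hK'
  have hle : DistanceCount.ndd v K' ≤ m := hS.ndd_le.trans (by exact_mod_cast hSm)
  refine ⟨heq, hle, fun s _ hs => ?_⟩
  have hms := DistanceCount.le_of_defect_eq (Fact.out : p.Prime).one_lt hK'.prop.1 hK'.prop.2 hm hs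
  exact heq.trans_le (hle.trans (by exact_mod_cast hms))
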